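/- Setting. An extended distance on a set \(X\) is a symmetric function \(\mathsf d\colon X\times X\to[0,+\infty]\) that satisfies the triangle inequality and vanishes exactly on the diagonal. For \(f\colon X\to\mathbb R\) and \(A\subseteq X\) let \[\mathrm{Lip}(f,A,\mathsf d):=\sup\Big\{\tfrac{|f(x)-f(y)|}{\mathsf d(x,y)}: x,y\in A,\ x\neq y\Big\}\] (with \(\sup\varnothing=0\) and \(a/\infty=0\)), and \(\mathrm{Lip}(f,\mathsf d):=\mathrm{Lip}(f,X,\mathsf d)\). Given a topology \(\tau\) on \(X\), let \(\mathrm{Lip}_b(X,\tau,\mathsf d)\) be the algebra of bounded, \(\tau\)-continuous, \(\mathsf d\)-Lipschitz functions \(f\colon X\to\mathbb R\), with the norm \(\|f\|_{\mathrm{Lip}_b(X,\tau,\mathsf d)}:=\mathrm{Lip}(f,\mathsf d)+\sup_X|f|\), and let \(\mathrm{Lip}_{b,1}(X,\tau,\mathsf d)\) be the set of those \(f\) in it with \(\mathrm{Lip}(f,\mathsf d)\le 1\). The asymptotic slope of \(f\) at \(x\) is \(\mathrm{lip}_{\mathsf d}(f)(x):=\inf\{\mathrm{Lip}(f,U,\mathsf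 d): x\in U\in\tau\}\). An extended metric-topological measure space \((X,\tau,\mathsf d,\mathfrak m)\) consists of a set \(X\) with an extended distance \(\mathsf d\), a Hausdorff topology \(\tau\) and a finite Radon measure \(\mathfrak m\) (a finite Borel measure that is inner regular with respect to \(\tau\)-compact sets), such that \(\tau\) is the initial topology of \(\mathrm{Lip}_b(X,\tau,\mathsf d)\) and \(\mathsf d(x,y)=\sup\{|f(x)-f(y)|: f\in\mathrm{Lip}_{b,1}(X,\tau,\mathsf d)\}\) for all \(x,y\in X\). Its canonical uniformity is the uniform structure induced by the semidistances \(\delta_f(x,y):=|f(x)-f(y)|\), \(f\in\mathrm{Lip}_{b,1}(X,\tau,\mathsf d)\). Let \(\mathfrak B_{\tau,\mathsf d}\) be the set of its entourages \(\mathcal U\) that are symmetric and open in the product topology on \(X\times X\), and write \(\mathcal U[x]:=\{y\in X:(x,y)\in\mathcal U\}\). A Lipschitz derivation is a linear operator \(b\colon\mathrm{Lip}_b(X,\tau,\mathsf d)\to L^0(\mathfrak m)\) (the space of \(\mathfrak m\)-a.e. classes of real-valued Borel functions) such that \(b(fh)=f\,b(h)+h\,b(f)\) for all \(f,h\). It is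 local if for every \(f\) one has \(b(f)=0\) \(\mathfrak m\)-a.e. on \(\{f=0\}\). Proposition. Let \((X,\tau,\mathsf d,\mathfrak m)\) be an extended metric-topological measure space and let \(b\) be a local Lipschitz derivation on it. Assume that there is \(g\in L^0(\mathfrak m)\), \(g\ge 0\), such that \[|b(f)|\le g\,\|f\|_{\mathrm{Lip}_b(X,\tau,\mathsf d)}\quad\mathfrak m\text{-a.e. on }X,\ \text{for every }f\in\mathrm{Lip}_b(X,\tau,\mathsf d).\] Let \(C\subseteq X\) be \(\tau\)-closed. Then for every \(\mathcal U\in\mathfrak B_{\tau,\mathsf d}\) and every \(f\in\mathrm{Lip}_b(X,\tau,\mathsf d)\), \[|b(f)|(x)\le g(x)\,\mathrm{Lip}(f,C\cap\mathcal U[x],\mathsf d)\quad\text{for }\mathfrak m\text{-a.e. }x\in C.\] In particular, if the topology \(\tau\) is metrisable on \(C\), then for every \(f\in\mathrm{Lip}_b(X,\tau,\mathsf d)\), \[|b(f)|\le g\,\mathrm{lip}_{\mathsf d_C}(f|_C)\quad\mathfrak m\text{-a.e. on }C,\] where \(\mathsf d_C:=\mathsf d|_{C\times C}\) and the asymptotic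 slope is computed on \(C\) with the subspace topology. -/

import Mathlib

open MeasureTheory
open scoped ENNReal NNReal

/-- `d` is an extended distance on `X`: symmetric, satisfying the triangle inequality, and
vanishing exactly on the diagonal. It is kept apart from the topology of `X`. -/
structure IsExtDist {X : Type*} (d : X → X → ℝ≥0∞) : Prop where
  symm : ∀ x y, d x y = d y x
  triangle : ∀ x y z, d x z ≤ d x y + d y z
  eq_zero_iff : ∀ x y, d x y = 0 ↔ x = y

/-- `Lip(f, A, d)`, the supremum of `|f x - f y| / d x y` over distinct `x, y ∈ A`
(it is `0` if there are no such points; the quotient is `0` where `d x y = ∞`). -/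
noncomputable def lipConst {X : Type*} (d : X → X → ℝ≥0∞) (f : X → ℝ) (A : Set X) : ℝ≥0∞ :=
  ⨆ x ∈ A, ⨆ y ∈ A, ⨆ _ : x ≠ y, ENNReal.ofReal |f x - f y| / d x y

/-- The algebra `Lip_b(X, τ, d)` of bounded, `τ`-continuous, `d`-Lipschitz functions. -/
def LipB {X : Type*} [TopologicalSpace X] (d : X → X → ℝ≥0∞) : Subalgebra ℝ (X → ℝ) where
  carrier := {f | Continuous f ∧ (∃ M : ℝ, ∀ x, |f x| ≤ M) ∧
    ∃ L : ℝ≥0, ∀ x y, ENNReal.ofReal |f x - f y| ≤ L * d x y}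
  mul_mem' := by
    rintro f g ⟨hf, ⟨M, hM⟩, L, hL⟩ ⟨hg, ⟨N, hN⟩, K, hK⟩
    refine ⟨hf.mul hg, ⟨M * N, fun x => ?_⟩, M.toNNReal * K + N.toNNReal * L, fun x y => ?_⟩
    · rw [Pi.mul_apply, abs_mul]
      exact mul_le_mul (hM x) (hN x) (abs_nonneg _) ((abs_nonneg _).trans (hM x))
    · have hM0 : 0 ≤ M := (abs_nonneg _).trans (hM x)
      have hN0 : 0 ≤ N := (abs_nonneg _).trans (hN x)
      have key : |(f * g) x - (f * g) y| ≤ M * |g x - g y| + N * |f x - f y| := by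
        have e : (f * g) x - (f * g) y = f x * (g x - g y) + g y * (f x - f y) := by
          simp only [Pi.mul_apply]; ring
        rw [e]
        refine (abs_add_le _ _).trans ?_
        rw [abs_mul, abs_mul]
        have := hM x
        have := hN y
        gcongr
      refine (ENNReal.ofReal_le_ofReal key).trans ?_
      rw [ENNReal.ofReal_add (by positivity) (by positivity), ENNReal.ofReal_mul hM0,
        ENNReal.ofReal_mul hN0]
      push_cast
      rw [add_mul, mul_assoc, mul_assoc]
      exact add_le_add (mul_le_mul' le_rfl (hK x y)) (mul_le_mul' le_rfl (hL x y))
  add_mem' := by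
    rintro f g ⟨hf, ⟨M, hM⟩, L, hL⟩ ⟨hg, ⟨N, hN⟩, K, hK⟩
    refine ⟨hf.add hg, ⟨M + N, fun x => (abs_add_le _ _).trans (add_le_add (hM x) (hN x))⟩,
      L + K, fun x y => ?_⟩
    have key : |(f + g) x - (f + g) y| ≤ |f x - f y| + |g x - g y| := by
      have e : (f + g) x - (f + g) y = (f x - f y) + (g x - g y) := by
        simp only [Pi.add_apply]; ring
      rw [e]
      exact abs_add_le _ _
    refine (ENNReal.ofReal_le_ofReal key).trans ?_
    rw [ENNReal.ofReal_add (abs_nonneg _) (abs_nonneg _)]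
    push_cast
    rw [add_mul]
    exact add_le_add (hL x y) (hK x y)
  algebraMap_mem' r :=
    ⟨continuous_const, ⟨|r|, fun _ => le_of_eq (by simp)⟩, 0, fun x y => by simp⟩

/-- The norm of `Lip_b(X, τ, d)`: Lipschitz constant plus supremum norm. -/
noncomputable def lipNorm {X : Type*} (d : X → X → ℝ≥0∞) (f : X → ℝ) : ℝ≥0∞ :=
  lipConst d f Set.univ + ⨆ x, ENNReal.ofReal |f x|

/-- `Lip_{b,1}(X, τ, d)`: the elements of `Lip_b(X, τ, d)` with Lipschitz constant at most `1`. -/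
def LipB1 {X : Type*} [TopologicalSpace X] (d : X → X → ℝ≥0∞) : Set (X → ℝ) :=
  {f | f ∈ LipB d ∧ lipConst d f Set.univ ≤ 1}

/-- `(X, τ, d)` is an extended metric-topological space, `τ` being the topology instance of `X`. -/
structure IsExtMetricTopSpace {X : Type*} [τ : TopologicalSpace X] (d : X → X → ℝ≥0∞) : Prop
    extends IsExtDist d where
  t2 : T2Space X
  /-- `τ` is the initial topology of `Lip_b(X, τ, d)`. -/
  topology_eq : τ = ⨅ f : LipB d, TopologicalSpace.induced (f : X → ℝ) inferInstance
  /-- `d` is recovered from `Lip_{b,1}(X, τ, d)`. -/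
  dist_eq : ∀ x y, d x y = ⨆ f ∈ LipB1 d, ENNReal.ofReal |f x - f y|

/-- The canonical uniformity of `(X, τ, d)`: the uniform structure induced by the semidistances
`δ_f x y = |f x - f y|`, where `f` ranges over `Lip_{b,1}(X, τ, d)`. -/
@[reducible] noncomputable def canonicalUniformity {X : Type*} [TopologicalSpace X] (d : X → X → ℝ≥0∞) :
    UniformSpace X :=
  ⨅ f : LipB1 d, (PseudoMetricSpace.induced (f : X → ℝ) inferInstance).toUniformSpace

/-- The open symmetric entourages of the canonical uniformity (openness is with respect to the
product topology `τ × τ`). -/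
def openSymmEntourages {X : Type*} [TopologicalSpace X] (d : X → X → ℝ≥0∞) : Set (Set (X × X)) :=
  {U | U ∈ (canonicalUniformity d).uniformity ∧ IsOpen U ∧ ∀ x y, (x, y) ∈ U → (y, x) ∈ U}

/-- The asymptotic slope `lip_d(f)(x)`: the infimum of `Lip(f, U, d)` over the open sets `U`
that contain `x`. -/
noncomputable def asymptoticSlope {X : Type*} [TopologicalSpace X] (d : X → X → ℝ≥0∞)
    (f : X → ℝ) (x : X) : ℝ≥0∞ :=
  ⨅ (U : Set X) (_ : IsOpen U) (_ : x ∈ U), lipConst d f U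

/-- A Lipschitz derivation: a linear map from `Lip_b(X, τ, d)` to the space `L⁰(m)` of
`m`-a.e. classes of measurable real functions that satisfies the Leibniz rule. -/
structure LipDerivation {X : Type*} [TopologicalSpace X] [MeasurableSpace X]
    (d : X → X → ℝ≥0∞) (m : Measure X) extends LipB d →ₗ[ℝ] (X →ₘ[m] ℝ) where
  leibniz : ∀ f h : LipB d, ∀ᵐ x ∂m,
    toLinearMap (f * h) x = f.1 x * toLinearMap h x + h.1 x * toLinearMap f x

/-- A derivation `b` is local if `b f = 0` a.e. on `{f = 0}`, for every `f`. -/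
def LipDerivation.IsLocal {X : Type*} [TopologicalSpace X] [MeasurableSpace X]
    {d : X → X → ℝ≥0∞} {m : Measure X} (b : LipDerivation d m) : Prop :=
  ∀ f : LipB d, ∀ᵐ x ∂m, f.1 x = 0 → b.toLinearMap f x = 0

open Topology Filter

/-! The hypothesis bounds `b(f)` by the Lipschitz constant plus the sup norm, and locality allows
`f` to be replaced, on a compact `K`, by any function equal to it there up to a constant. If `f`
oscillates by at most ε on `K`, extend `f|K` with constant Lip(f,K)+ε
(`exists_isContLip_extension`), subtract a value of `f` and truncate to [-ε,ε]: the norm becomes at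
most Lip(f,K)+2ε. Up to a null set, `C` is a countable union of such `K` with `K ×ˢ K` inside a
given open neighbourhood of the diagonal, and ε → 0 gives `ae_le_of_isOpen`; both claims follow from
it.

The extension is the analytic core. Since `d` need not be τ-continuous, McShane's formula is applied
to finite maxima of |φ x - φ y|, which are, and the resulting error is removed by iteration. -/

/-- `f` is continuous and `L`-Lipschitz with respect to the extended distance `d`. -/
def IsContLip {X : Type*} [TopologicalSpace X] (d : X → X → ℝ≥0∞) (L : ℝ≥0) (f : X → ℝ) : Prop :=
  Continuous f ∧ ∀ x y, ENNReal.ofReal |f x - f y| ≤ L * d x y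

/-! ### Lipschitz extension from compact sets -/

section IsContLip

variable {X : Type*} [TopologicalSpace X] {d : X → X → ℝ≥0∞} {L : ℝ≥0} {f h : X → ℝ}

lemma IsContLip.max (hf : IsContLip d L f) (hh : IsContLip d L h) :
    IsContLip d L (fun x => max (f x) (h x)) := by
  refine ⟨hf.1.max hh.1, fun x y => ?_⟩
  refine (ENNReal.ofReal_le_ofReal (abs_max_sub_max_le_max _ _ _ _)).trans ?_
  rcases max_choice |f x - f y| |h x - h y| with e | e <;> rw [e]
  exacts [hf.2 x y, hh.2 x y]

lemma IsContLip.min (hf : IsContLip d L f) (hh : IsContLip d L h) :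
    IsContLip d L (fun x => min (f x) (h x)) := by
  refine ⟨hf.1.min hh.1, fun x y => ?_⟩
  refine (ENNReal.ofReal_le_ofReal (abs_min_sub_min_le_max _ _ _ _)).trans ?_
  rcases max_choice |f x - f y| |h x - h y| with e | e <;> rw [e]
  exacts [hf.2 x y, hh.2 x y]

lemma IsContLip.add_const (hf : IsContLip d L f) (c : ℝ) : IsContLip d L (fun x => f x + c) :=
  ⟨hf.1.add continuous_const, fun x y => by simpa using hf.2 x y⟩

lemma isContLip_const (c : ℝ) : IsContLip d L (fun _ : X => c) :=
  ⟨continuous_const, fun x y => by simp⟩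

/-- The supremum that defines `d` in terms of `Lip_{b,1}` is almost attained, uniformly also where
`d` is infinite. -/
lemma exists_mem_LipB1_lt (hd : IsExtMetricTopSpace d) {a ε : ℝ} (hε : 0 < ε) {x y : X}
    (ha : ENNReal.ofReal a ≤ L * d x y) : ∃ φ : LipB1 d, a < L * |φ.1 x - φ.1 y| + ε := by
  by_contra! H
  -- Testing with φ = 0 gives ε ≤ a, so `ENNReal.ofReal (a - ε)` is not truncated.
  have h0 : (0 : X → ℝ) ∈ LipB1 d := ⟨zero_mem _, by simp [lipConst]⟩
  have haε : ε ≤ a := by simpa using H ⟨0, h0⟩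
  have : (L : ℝ≥0∞) * d x y ≤ ENNReal.ofReal (a - ε) := by
    rw [hd.dist_eq x y, ENNReal.mul_iSup]
    refine iSup_le fun φ => ?_
    rw [ENNReal.mul_iSup]
    refine iSup_le fun hφ => ?_
    rw [← ENNReal.ofReal_coe_nnreal, ← ENNReal.ofReal_mul L.coe_nonneg]
    exact ENNReal.ofReal_le_ofReal (by linarith [H ⟨φ, hφ⟩])
  have h2 := ha.trans this
  rw [ENNReal.ofReal_le_ofReal_iff (by linarith)] at h2
  linarith

/-- A function that is Lipschitz on a compact set is, on that set, uniformly close to a continuous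
function on the whole space with the same Lipschitz constant. -/
lemma exists_isContLip_approx (hd : IsExtMetricTopSpace d) {K : Set X} (hK : IsCompact K)
    (hf : Continuous f) (hfK : ∀ x ∈ K, ∀ y ∈ K, ENNReal.ofReal |f x - f y| ≤ L * d x y)
    {ε : ℝ} (hε : 0 < ε) : ∃ k, IsContLip d L k ∧ ∀ x ∈ K, |k x - f x| ≤ ε := by
  rcases K.eq_empty_or_nonempty with rfl | hne
  · exact ⟨fun _ => 0, isContLip_const 0, by simp⟩
  obtain ⟨t, ht⟩ := (hK.prod hK).elim_finite_subcover
    (fun φ : LipB1 d => {p : X × X | f p.1 - f p.2 < L * |φ.1 p.1 - φ.1 p.2| + ε})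
    (fun φ => by
      have hφ : Continuous φ.1 := φ.2.1.1
      exact isOpen_lt (by fun_prop) (by fun_prop))
    (by
      rintro ⟨x, y⟩ ⟨hx, hy⟩
      obtain ⟨φ, hφ⟩ := exists_mem_LipB1_lt hd hε
        ((ENNReal.ofReal_le_ofReal (le_abs_self _)).trans (hfK x hx y hy))
      exact Set.mem_iUnion.2 ⟨φ, hφ⟩)
  -- A τ-continuous semidistance below `d`; by the finite subcover, `f` is `L`-Lipschitz for it on
  -- `K` up to ε.
  let ρ : X → X → ℝ≥0 := fun x y => t.sup fun φ => nndist (φ.1 x) (φ.1 y)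
  have ρ_self : ∀ x, ρ x x = 0 := fun x => by simp [ρ]
  have ρ_tri : ∀ x y z, ρ x z ≤ ρ x y + ρ y z := fun x y z =>
    Finset.sup_le fun φ hφ => (nndist_triangle _ (φ.1 y) _).trans
      (add_le_add (Finset.le_sup (f := fun φ : LipB1 d => nndist (φ.1 x) (φ.1 y)) hφ)
        (Finset.le_sup (f := fun φ : LipB1 d => nndist (φ.1 y) (φ.1 z)) hφ))
  have ρ_symm : ∀ x y, ρ x y = ρ y x := fun x y => by simp only [ρ, nndist_comm]
  have ρ_le : ∀ x y, (ρ x y : ℝ≥0∞) ≤ d x y := fun x y => by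
    simp only [ρ]
    rw [ENNReal.coe_finset_sup]
    refine Finset.sup_le fun φ _ => ?_
    rw [hd.dist_eq x y, ← edist_nndist, edist_dist, Real.dist_eq]
    exact le_iSup₂ (f := fun f (_ : f ∈ LipB1 d) => ENNReal.ofReal |f x - f y|) φ.1 φ.2
  have ρ_cont : ∀ x, Continuous (ρ x) := fun x =>
    Continuous.finset_sup_apply fun φ _ => by
      have hφ : Continuous φ.1 := φ.2.1.1
      fun_prop
  have key : ∀ x ∈ K, ∀ y ∈ K, f x - f y ≤ L * ρ x y + ε := fun x hx y hy => by
    obtain ⟨φ, hφt, hφ⟩ := Set.mem_iUnion₂.1 (ht (Set.mk_mem_prod hx hy))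
    have h1 : nndist (φ.1 x) (φ.1 y) ≤ ρ x y :=
      Finset.le_sup (f := fun φ : LipB1 d => nndist (φ.1 x) (φ.1 y)) hφt
    have h2 : |φ.1 x - φ.1 y| ≤ ρ x y := by
      rw [← Real.dist_eq, ← coe_nndist]; exact_mod_cast h1
    have h3 : f x - f y < L * |φ.1 x - φ.1 y| + ε := hφ
    have := mul_le_mul_of_nonneg_left h2 L.coe_nonneg
    linarith
  have : Nonempty K := hne.to_subtype
  obtain ⟨B, hB⟩ : BddBelow (f '' K) := (hK.image hf).bddBelow
  -- McShane's formula for `ρ`: taking y = x gives k ≤ f on `K`, and `key` gives k ≥ f - ε.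
  let k : X → ℝ := fun x => ⨅ y : K, (f y + L * ρ x y)
  have hbdd : ∀ x, BddBelow (Set.range fun y : K => f y + L * (ρ x y : ℝ)) := fun x =>
    ⟨B, by
      rintro _ ⟨y, rfl⟩
      have := hB ⟨y, y.2, rfl⟩
      have : 0 ≤ L * (ρ x y : ℝ) := by positivity
      simp only; linarith⟩
  have k_le : ∀ x x', k x ≤ k x' + L * ρ x x' := fun x x' => by
    rw [← sub_le_iff_le_add]
    refine le_ciInf fun y => ?_
    have h1 : k x ≤ f y + L * ρ x y := ciInf_le (hbdd x) y
    have h2 : (ρ x y : ℝ) ≤ ρ x x' + ρ x' y := by exact_mod_cast ρ_tri x x' y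
    have h3 := mul_le_mul_of_nonneg_left h2 L.coe_nonneg
    linarith
  have k_abs : ∀ x x', |k x - k x'| ≤ L * ρ x x' := fun x x' => by
    have h1 := k_le x x'
    have h2 := k_le x' x
    rw [ρ_symm x' x] at h2
    exact abs_le.2 ⟨by linarith, by linarith⟩
  refine ⟨k, ⟨?_, fun x y => ?_⟩, fun x hx => ?_⟩
  · refine continuous_iff_continuousAt.2 fun x => ?_
    rw [ContinuousAt, tendsto_iff_dist_tendsto_zero]
    have hlim : Tendsto (fun y => (L : ℝ) * ρ x y) (𝓝 x) (𝓝 0) := by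
      have : Continuous fun y => (L : ℝ) * ρ x y := by
        have := ρ_cont x
        fun_prop
      simpa [ρ_self] using this.tendsto x
    refine squeeze_zero (fun _ => dist_nonneg) (fun y => ?_) hlim
    rw [dist_comm, Real.dist_eq]
    exact k_abs x y
  · refine (ENNReal.ofReal_le_ofReal (k_abs x y)).trans ?_
    rw [ENNReal.ofReal_mul L.coe_nonneg, ENNReal.ofReal_coe_nnreal, ENNReal.ofReal_coe_nnreal]
    exact mul_le_mul' le_rfl (ρ_le x y)
  · have h1 : k x ≤ f x + L * ρ x x := ciInf_le (hbdd x) ⟨x, hx⟩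
    have h2 : f x - ε ≤ k x := le_ciInf fun y => by linarith [key x hx y y.2]
    rw [ρ_self] at h1
    simp only [NNReal.coe_zero, mul_zero, add_zero] at h1
    exact abs_le.2 ⟨by linarith, by linarith⟩

/-- Extension of Lipschitz functions from compact sets, preserving the Lipschitz constant. -/
lemma exists_isContLip_extension (hd : IsExtMetricTopSpace d) {K : Set X} (hK : IsCompact K)
    (hf : Continuous f) (hfK : ∀ x ∈ K, ∀ y ∈ K, ENNReal.ofReal |f x - f y| ≤ L * d x y) :
    ∃ k, IsContLip d L k ∧ ∀ x ∈ K, k x = f x := by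
  let ε : ℕ → ℝ := fun n => 1 * (1 / 2) ^ n
  have hε : ∀ n, 0 < ε n := fun n => by positivity
  choose k hkL hkf using fun n => exists_isContLip_approx hd hK hf hfK (hε n)
  -- Clamp `k (n + 1)` to the band of width `ε n` around `u n`. On `K` the band contains `f`, so the
  -- accuracy `ε (n + 1)` survives; everywhere else the clamp forces uniform convergence, and max
  -- and min keep the constant `L`.
  let u : ℕ → X → ℝ := fun n => Nat.rec (k 0)
    (fun n v x => max (v x + -ε n) (min (v x + ε n) (k (n + 1) x))) n
  have u_succ : ∀ n x, u (n + 1) x = max (u n x + -ε n) (min (u n x + ε n) (k (n + 1) x)) :=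
    fun _ _ => rfl
  have uL : ∀ n, IsContLip d L (u n) := fun n => by
    induction n with
    | zero => exact hkL 0
    | succ n ih => exact (ih.add_const _).max ((ih.add_const _).min (hkL _))
  have uf : ∀ n, ∀ x ∈ K, |u n x - f x| ≤ ε n := fun n => by
    induction n with
    | zero => exact hkf 0
    | succ n ih =>
      intro x hx
      have h1 := abs_le.1 (ih x hx)
      have h2 := abs_le.1 (hkf (n + 1) x hx)
      have h3 := hε (n + 1)
      rw [u_succ]
      refine abs_le.2 ⟨?_, ?_⟩
      · have : f x - ε (n + 1) ≤ min (u n x + ε n) (k (n + 1) x) :=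
          le_min (by linarith) (by linarith)
        linarith [le_max_right (u n x + -ε n) (min (u n x + ε n) (k (n + 1) x))]
      · have : max (u n x + -ε n) (min (u n x + ε n) (k (n + 1) x)) ≤ f x + ε (n + 1) :=
          max_le (by linarith) ((min_le_right _ _).trans (by linarith))
        linarith
  have ud : ∀ x n, dist (u n x) (u (n + 1) x) ≤ 1 * (1 / 2) ^ n := fun x n => by
    have h3 : 0 < ε n := hε n
    change _ ≤ ε n
    rw [dist_comm, Real.dist_eq, u_succ]
    refine abs_le.2 ⟨?_, ?_⟩
    · linarith [le_max_left (u n x + -ε n) (min (u n x + ε n) (k (n + 1) x))]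
    · have : max (u n x + -ε n) (min (u n x + ε n) (k (n + 1) x)) ≤ u n x + ε n :=
        max_le (by linarith) (min_le_left _ _)
      linarith
  have hr : (1 / 2 : ℝ) < 1 := by norm_num
  choose h hh using fun x =>
    cauchySeq_tendsto_of_complete (cauchySeq_of_le_geometric (1 / 2) 1 hr (ud x))
  have ε0 : Tendsto ε atTop (𝓝 0) := by
    simpa [ε] using tendsto_pow_atTop_nhds_zero_of_lt_one (r := (1 / 2 : ℝ)) (by norm_num) hr
  have hunif : TendstoUniformly u h atTop := by
    rw [Metric.tendstoUniformly_iff]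
    intro δ hδ
    have : Tendsto (fun n => ε n / (1 - 1 / 2)) atTop (𝓝 0) := by
      simpa using ε0.div_const (1 - 1 / 2 : ℝ)
    filter_upwards [this.eventually_lt_const hδ] with n hn x
    rw [dist_comm]
    exact (dist_le_of_le_geometric_of_tendsto (1 / 2) 1 hr (ud x) (hh x) n).trans_lt hn
  refine ⟨h, ⟨hunif.continuous (Frequently.of_forall fun n => (uL n).1), fun x y => ?_⟩,
    fun x hx => ?_⟩
  · have : Tendsto (fun n => ENNReal.ofReal |u n x - u n y|) atTop
        (𝓝 (ENNReal.ofReal |h x - h y|)) :=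
      ENNReal.tendsto_ofReal ((hh x).sub (hh y)).abs
    exact le_of_tendsto' this fun n => (uL n).2 x y
  · have h1 : Tendsto (fun n => |u n x - f x|) atTop (𝓝 |h x - f x|) :=
      ((hh x).sub tendsto_const_nhds).abs
    have h2 : |h x - f x| ≤ 0 := le_of_tendsto_of_tendsto' h1 ε0 fun n => uf n x hx
    exact sub_eq_zero.1 (abs_nonpos_iff.1 h2)

end IsContLip

/-! ### Lipschitz constants on subsets -/

section lipConst

variable {X : Type*} {d : X → X → ℝ≥0∞} {f : X → ℝ}

lemma lipConst_mono {A B : Set X} (h : A ⊆ B) : lipConst d f A ≤ lipConst d f B :=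
  iSup₂_le fun x hx => iSup₂_le fun y hy =>
    le_iSup₂_of_le x (h hx) (le_iSup₂_of_le y (h hy) le_rfl)

lemma lipConst_le_of_forall {A : Set X} {L : ℝ≥0∞}
    (h : ∀ x ∈ A, ∀ y ∈ A, ENNReal.ofReal |f x - f y| ≤ L * d x y) : lipConst d f A ≤ L :=
  iSup₂_le fun x hx => iSup₂_le fun y hy => iSup_le fun _ => ENNReal.div_le_of_le_mul (h x hx y hy)

/-- Positivity of `L` matters at infinite distance: such pairs contribute 0 to `lipConst`, and the
bound holds there only because L * ∞ = ∞. -/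
lemma ofReal_abs_sub_le_mul (hd : IsExtDist d) {A : Set X} {L : ℝ≥0} (hL : 0 < L)
    (h : lipConst d f A ≤ L) {x y : X} (hx : x ∈ A) (hy : y ∈ A) :
    ENNReal.ofReal |f x - f y| ≤ L * d x y := by
  rcases eq_or_ne x y with rfl | hxy
  · simp
  by_cases ht : d x y = ∞
  · simp [ht, ENNReal.mul_top, hL.ne']
  have h0 : d x y ≠ 0 := fun e => hxy ((hd.eq_zero_iff x y).1 e)
  rw [← ENNReal.div_le_iff h0 ht]
  refine le_trans ?_ h
  exact le_iSup₂_of_le x hx (le_iSup₂_of_le y hy (le_iSup_of_le hxy le_rfl))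

lemma lipConst_lt_top_of_mem [TopologicalSpace X] (f : LipB d) (A : Set X) : lipConst d f.1 A < ∞ := by
  obtain ⟨L, hL⟩ := f.2.2.2
  exact (lipConst_le_of_forall fun x _ y _ => hL x y).trans_lt ENNReal.coe_lt_top

end lipConst

/-! ### Local estimates for derivations -/

section Derivation

variable {X : Type*} [TopologicalSpace X] [MeasurableSpace X]
  {d : X → X → ℝ≥0∞} {m : Measure X}

lemma LipDerivation.map_one (b : LipDerivation d m) : b.toLinearMap 1 = 0 := by
  refine AEEqFun.ext ?_
  filter_upwards [b.leibniz 1 1, AEEqFun.coeFn_zero (α := X) (μ := m) (β := ℝ)] with x hx h0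
  rw [h0]
  rw [mul_one] at hx
  have : ((1 : LipB d) : X → ℝ) x = 1 := rfl
  rw [this] at hx
  simp only [Pi.zero_apply]
  linarith

/-- A local derivation depends on `f` only up to constants on the set under consideration. -/
lemma LipDerivation.IsLocal.ae_eq_of_eqOn {b : LipDerivation d m} (hb : b.IsLocal) {K : Set X}
    {f h : LipB d} {c : ℝ} (hfh : ∀ x ∈ K, f.1 x = h.1 x + c) :
    ∀ᵐ x ∂m, x ∈ K → b.toLinearMap f x = b.toLinearMap h x := by
  have e : b.toLinearMap (f - h - c • 1) = b.toLinearMap f - b.toLinearMap h := by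
    rw [map_sub, map_sub, map_smul, b.map_one, smul_zero, sub_zero]
  filter_upwards [hb (f - h - c • 1),
    AEEqFun.coeFn_sub (b.toLinearMap f) (b.toLinearMap h)] with x hx hs hxK
  rw [e, hs] at hx
  have : (f - h - c • 1 : LipB d).1 x = f.1 x - h.1 x - c * 1 := rfl
  rw [this] at hx
  exact sub_eq_zero.1 (hx (by linarith [hfh x hxK]))

/-- The estimate on a compact set where `f` has small oscillation. -/
lemma LipDerivation.IsLocal.ae_le_of_isCompact {b : LipDerivation d m} (hb : b.IsLocal)
    (hd : IsExtMetricTopSpace d) {g : X →ₘ[m] ℝ}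
    (hbg : ∀ f : LipB d, ∀ᵐ x ∂m,
      ENNReal.ofReal |b.toLinearMap f x| ≤ ENNReal.ofReal (g x) * lipNorm d f.1)
    {K : Set X} (hK : IsCompact K) (f : LipB d) {ε : ℝ≥0} (hε : 0 < ε)
    (hf : ∀ x ∈ K, ∀ y ∈ K, |f.1 x - f.1 y| ≤ ε) :
    ∀ᵐ x ∂m, x ∈ K → ENNReal.ofReal |b.toLinearMap f x| ≤
      ENNReal.ofReal (g x) * (lipConst d f.1 K + ε + ε) := by
  rcases K.eq_empty_or_nonempty with rfl | ⟨x₀, hx₀⟩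
  · simp
  have hL := lipConst_lt_top_of_mem f K
  lift lipConst d f.1 K to ℝ≥0 using hL.ne with L hLK
  have hpos : 0 < L + ε := by positivity
  obtain ⟨k, hk, hkf⟩ := exists_isContLip_extension hd hK f.2.1
    (fun x hx y hy => ofReal_abs_sub_le_mul hd.toIsExtDist hpos (by rw [← hLK]; simp) hx hy)
  set c := f.1 x₀
  -- The truncation makes the sup norm at most ε and is inactive on `K`, where `k` = `f` stays
  -- within ε of `c`.
  let k' : X → ℝ := fun x => max (-ε) (min ε (k x + -c))
  have hk' : IsContLip d (L + ε) k' :=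
    (isContLip_const _).max ((isContLip_const _).min (hk.add_const _))
  have k'_le : ∀ x, |k' x| ≤ ε := fun x =>
    abs_le.2 ⟨le_max_left _ _, max_le (by linarith [ε.2]) (min_le_left _ _)⟩
  let h : LipB d := ⟨k', hk'.1, ⟨ε, k'_le⟩, L + ε, hk'.2⟩
  have hnorm : lipNorm d h.1 ≤ L + ε + ε := by
    refine add_le_add ?_ (iSup_le fun x => ?_)
    · exact_mod_cast lipConst_le_of_forall fun x _ y _ => hk'.2 x y
    · rw [← ENNReal.ofReal_coe_nnreal]
      exact ENNReal.ofReal_le_ofReal (k'_le x)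
  have hfh : ∀ x ∈ K, f.1 x = h.1 x + c := fun x hx => by
    have h1 := abs_le.1 (hf x hx x₀ hx₀)
    change f.1 x = max (-(ε : ℝ)) (min ε (k x + -c)) + c
    rw [hkf x hx, min_eq_right (by linarith), max_eq_right (by linarith)]
    ring
  filter_upwards [hb.ae_eq_of_eqOn hfh, hbg h] with x hx hxg hxK
  rw [hx hxK]
  exact hxg.trans (mul_le_mul' le_rfl hnorm)

/-- Up to a null set, a closed set is a countable union of compact sets. -/
lemma exists_seq_isCompact_ae_cover [T2Space X] [BorelSpace X] [IsFiniteMeasure m] [m.InnerRegular]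
    {C : Set X} (hC : IsClosed C) :
    ∃ K : ℕ → Set X, (∀ n, IsCompact (K n) ∧ K n ⊆ C) ∧ ∀ᵐ x ∂m, x ∈ C → ∃ n, x ∈ K n := by
  choose K hKC hK hKm using fun n : ℕ => hC.measurableSet.exists_isCompact_sdiff_lt
    (μ := m) (measure_ne_top m C) (ε := (n : ℝ≥0∞)⁻¹) (by simp)
  refine ⟨K, fun n => ⟨hK n, hKC n⟩, ?_⟩
  have h0 : m (C \ ⋃ n, K n) = 0 := by
    refine le_antisymm (ge_of_tendsto' ENNReal.tendsto_inv_nat_nhds_zero fun n => ?_) zero_le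
    exact (measure_mono (Set.sdiff_subset_sdiff_right (Set.subset_iUnion K n))).trans (hKm n).le
  filter_upwards [measure_eq_zero_iff_ae_notMem.1 h0] with x hx hxC
  by_contra hn
  exact hx ⟨hxC, fun h => hn (Set.mem_iUnion.1 h)⟩

/-- The localised estimate, for an arbitrary open neighbourhood `V` of the diagonal of `C`. -/
lemma LipDerivation.IsLocal.ae_le_of_isOpen [BorelSpace X] [IsFiniteMeasure m] [m.InnerRegular]
    {b : LipDerivation d m} (hb : b.IsLocal)
    (hd : IsExtMetricTopSpace d) {g : X →ₘ[m] ℝ}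
    (hbg : ∀ f : LipB d, ∀ᵐ x ∂m,
      ENNReal.ofReal |b.toLinearMap f x| ≤ ENNReal.ofReal (g x) * lipNorm d f.1)
    {C : Set X} (hC : IsClosed C) {V : Set (X × X)} (hV : IsOpen V) (hCV : ∀ x ∈ C, (x, x) ∈ V)
    (f : LipB d) :
    ∀ᵐ x ∂m, x ∈ C → ENNReal.ofReal |b.toLinearMap f x| ≤
      ENNReal.ofReal (g x) * lipConst d f.1 (C ∩ {y | (x, y) ∈ V}) := by
  have := hd.t2
  obtain ⟨K, hK, hKC⟩ := exists_seq_isCompact_ae_cover (m := m) hC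
  have main : ∀ (ε : ℝ≥0), 0 < ε → ∀ n, ∀ᵐ x ∂m, x ∈ K n →
      ENNReal.ofReal |b.toLinearMap f x| ≤
        ENNReal.ofReal (g x) * (lipConst d f.1 (C ∩ {y | (x, y) ∈ V}) + ε + ε) := by
    intro ε hε n
    have hfc : Continuous f.1 := f.2.1
    have hO : IsOpen (V ∩ {p : X × X | |f.1 p.1 - f.1 p.2| < ε}) :=
      hV.inter (isOpen_lt (by fun_prop) continuous_const)
    have : ∀ x : K n, ∃ W : Set X, IsOpen W ∧ x.1 ∈ W ∧
        W ×ˢ W ⊆ V ∩ {p : X × X | |f.1 p.1 - f.1 p.2| < ε} := fun x => by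
      obtain ⟨A, B, hA, hB, hxA, hxB, hAB⟩ := isOpen_prod_iff.1 hO x.1 x.1
        ⟨hCV _ ((hK n).2 x.2), by simpa using hε⟩
      exact ⟨A ∩ B, hA.inter hB, ⟨hxA, hxB⟩,
        (Set.prod_mono Set.inter_subset_left Set.inter_subset_right).trans hAB⟩
    choose W hWo hxW hW using this
    obtain ⟨t, ht⟩ := (hK n).1.elim_finite_subcover W hWo
      fun x hx => Set.mem_iUnion.2 ⟨⟨x, hx⟩, hxW _⟩
    -- Compact pieces inside the `W i`: on each one `f` oscillates by less than ε, and its square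
    -- lies in `V`.
    obtain ⟨Q, hQc, hQW, hQ⟩ := (hK n).1.finite_compact_cover t W (fun i _ => hWo i) ht
    have hest : ∀ i, ∀ᵐ x ∂m, i ∈ t → x ∈ Q i → ENNReal.ofReal |b.toLinearMap f x| ≤
        ENNReal.ofReal (g x) * (lipConst d f.1 (Q i) + ε + ε) := fun i =>
      (hb.ae_le_of_isCompact hd hbg (hQc i) f hε fun x hx y hy =>
        (hW i (Set.mk_mem_prod (hQW i hx) (hQW i hy))).2.le).mono fun _ h _ => h
    have hall : ∀ᵐ x ∂m, ∀ i ∈ t, x ∈ Q i → ENNReal.ofReal |b.toLinearMap f x| ≤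
        ENNReal.ofReal (g x) * (lipConst d f.1 (Q i) + ε + ε) :=
      (Finset.eventually_all t).2 fun i hi => (hest i).mono fun _ h => h hi
    filter_upwards [hall] with x hx hxK
    rw [hQ] at hxK
    obtain ⟨i, hi, hxi⟩ := Set.mem_iUnion₂.1 hxK
    refine (hx i hi hxi).trans ?_
    gcongr
    refine lipConst_mono fun y hy => ⟨(hK n).2 ?_, ?_⟩
    · rw [hQ]; exact Set.mem_iUnion₂.2 ⟨i, hi, hy⟩
    · exact (hW i (Set.mk_mem_prod (hQW i hxi) (hQW i hy))).1
  -- Only countably many ε are used, so the exceptional sets stay null in the limit.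
  have hall : ∀ᵐ x ∂m, ∀ j n : ℕ, x ∈ K n → ENNReal.ofReal |b.toLinearMap f x| ≤
      ENNReal.ofReal (g x) * (lipConst d f.1 (C ∩ {y | (x, y) ∈ V}) +
        ((1 / (j + 1) : ℝ≥0) : ℝ≥0∞) + ((1 / (j + 1) : ℝ≥0) : ℝ≥0∞)) :=
    ae_all_iff.2 fun j => ae_all_iff.2 fun n => main _ (by positivity) n
  filter_upwards [hKC, hall] with x hx hxall hxC
  obtain ⟨n, hn⟩ := hx hxC
  have h0 : Tendsto (fun j : ℕ => ((1 / (j + 1) : ℝ≥0) : ℝ≥0∞)) atTop (𝓝 0) := by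
    exact ENNReal.tendsto_coe.2 (tendsto_one_div_add_atTop_nhds_zero_nat (𝕜 := ℝ≥0))
  have h1 := ENNReal.Tendsto.const_mul (a := ENNReal.ofReal (g x))
    ((tendsto_const_nhds (x := lipConst d f.1 (C ∩ {y | (x, y) ∈ V}))).add h0 |>.add h0)
    (Or.inr ENNReal.ofReal_ne_top)
  rw [add_zero, add_zero] at h1
  exact ge_of_tendsto' h1 fun j => hxall j n hn

end Derivation

theorem proposition4p13 {X : Type*} [TopologicalSpace X] [MeasurableSpace X] [BorelSpace X]
    (d : X → X → ℝ≥0∞) (hd : IsExtMetricTopSpace d)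
    (m : Measure X) [IsFiniteMeasure m] [m.InnerRegular]
    (b : LipDerivation d m) (hb : b.IsLocal)
    (g : X →ₘ[m] ℝ) (hg : 0 ≤ g)
    (hbg : ∀ f : LipB d, ∀ᵐ x ∂m,
      ENNReal.ofReal |b.toLinearMap f x| ≤ ENNReal.ofReal (g x) * lipNorm d f.1)
    (C : Set X) (hC : IsClosed C) :
    (∀ U ∈ openSymmEntourages d, ∀ f : LipB d, ∀ᵐ x ∂m, x ∈ C →
      ENNReal.ofReal |b.toLinearMap f x| ≤
        ENNReal.ofReal (g x) * lipConst d f.1 (C ∩ {y | (x, y) ∈ U})) ∧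
    (TopologicalSpace.MetrizableSpace C → ∀ f : LipB d, ∀ᵐ x ∂m, ∀ hx : x ∈ C,
      ENNReal.ofReal |b.toLinearMap f x| ≤
        ENNReal.ofReal (g x) *
          asymptoticSlope (fun y z : C => d y z) (fun y : C => f.1 y) ⟨x, hx⟩) := by
  refine ⟨fun U hU f => hb.ae_le_of_isOpen hd hbg hC hU.2.1
    (fun x _ => @refl_mem_uniformity _ (canonicalUniformity d) x U hU.1) f, fun hmetr f => ?_⟩
  let := TopologicalSpace.metrizableSpaceMetric C
  -- Metric neighbourhoods of the diagonal of `C` are traces of open sets of `X × X`; countably many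
  -- radii give one null set.
  have hball : ∀ n : ℕ, ∃ V : Set (X × X), IsOpen V ∧
      ∀ y z : C, (y.1, z.1) ∈ V ↔ dist y z < 1 / (n + 1) := fun n => by
    have hO : IsOpen {p : C × C | dist p.1 p.2 < 1 / ((n : ℝ) + 1)} :=
      isOpen_lt continuous_dist continuous_const
    obtain ⟨V, hV, hVO⟩ :=
      (IsInducing.subtypeVal.prodMap IsInducing.subtypeVal).isOpen_iff.1 hO
    exact ⟨V, hV, fun y z => Set.ext_iff.1 hVO (y, z)⟩
  choose V hVo hV using hball
  have hall := ae_all_iff.2 fun n => hb.ae_le_of_isOpen hd hbg hC (hVo n)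
    (fun x hx => (hV n ⟨x, hx⟩ ⟨x, hx⟩).2 (by rw [dist_self]; positivity)) f
  filter_upwards [hall] with x hx hxC
  -- A zero factor cannot be moved inside the nested infima: over a false condition the infimum is
  -- ∞, and 0 * ∞ = 0.
  rcases eq_or_ne (ENNReal.ofReal (g x)) 0 with hg0 | hg0
  · simpa [hg0] using hx 0 hxC
  simp only [asymptoticSlope, ENNReal.mul_iInf_of_ne hg0 ENNReal.ofReal_ne_top]
  refine le_iInf fun W => le_iInf fun hW => le_iInf fun hxW => ?_
  obtain ⟨δ, hδ, hδW⟩ := Metric.isOpen_iff.1 hW _ hxW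
  obtain ⟨n, hn⟩ := exists_nat_one_div_lt hδ
  have hsub : ∀ y : C, (x, y.1) ∈ V n → y ∈ W := fun y hy => hδW <| by
    rw [Metric.mem_ball, dist_comm]
    exact ((hV n ⟨x, hxC⟩ y).1 hy).trans hn
  refine (hx n hxC).trans (mul_le_mul' le_rfl ?_)
  refine iSup₂_le fun y hy => iSup₂_le fun z hz => iSup_le fun hyz => ?_
  exact le_iSup₂_of_le (⟨y, hy.1⟩ : C) (hsub _ hy.2) (le_iSup₂_of_le (⟨z, hz.1⟩ : C) (hsub _ hz.2)
    (le_iSup_of_le (fun e => hyz (congrArg Subtype.val e)) le_rfl))
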